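/- **Theorem 3.1 (boundedness of the maximal operator on Morrey spaces).** Let $\mathbb G$ be a homogeneous group, that is, a Lie group structure on the manifold $\mathbb R^N$ together with exponents $\nu_1,\dots,\nu_N>0$ such that for every $t>0$ the dilation $D_t(x)=(t^{\nu_1}x_1,\dots,t^{\nu_N}x_N)$ is an automorphism of $\mathbb G$; let $Q=\nu_1+\dots+\nu_N$ and let $dx$ be Lebesgue measure. Let $|\cdot|:\mathbb G\to[0,\infty)$ be any homogeneous quasi-norm, that is, a continuous function with $|x^{-1}|=|x|$, $|D_t(x)|=t|x|$ for $t>0$, and $|x|=0$ if and only if $x=0$; put $B(x,r)=\{y\in\mathbb G:|x^{-1}y|<r\}$. For $1<p<\infty$ and $0<\lambda<Q$ let $$\|f\|_{M^\lambda_p(\mathbb G)}=\Big(\sup_{x\in\mathbb G}\sup_{r>0}r^{-\lambda}\int_{B(x,r)}|f(y)|^p\,dy\Big)^{1/p},$$ and let $M^\lambda_p(\mathbb G)$ be the set of real functions $f\in L^p_{\mathrm{loc}}(\mathbb G)$ with $\|f\|_{M^\lambda_p(\mathbb G)}<\infty$. Let $$M_0u(x)=\sup_{r>0}\frac1{|B(x,r)|}\int_{B(x,r)}|u(y)|\,dy\in[0,\infty],$$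 where $|B(x,r)|$ denotes the Lebesgue measure of $B(x,r)$. Then there is a finite constant $C$ such that for every $u\in M^\lambda_p(\mathbb G)$ the function $M_0u$ is finite almost everywhere, belongs to $M^\lambda_p(\mathbb G)$, and satisfies $$\|M_0u\|_{M^\lambda_p(\mathbb G)}\le C\,\|u\|_{M^\lambda_p(\mathbb G)}.$$ -/

import Mathlib

open MeasureTheory
open scoped ENNReal NNReal ContDiff

noncomputable section

/-- The space `ℝ^N`, on which the group lives; its `volume` is Lebesgue measure `dx`. -/
abbrev RSpace (N : ℕ) : Type := EuclideanSpace ℝ (Fin N)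

/-- The dilation `D_t (x) = (t ^ ν₁ x₁, …, t ^ ν_N x_N)`. -/
def dilation {N : ℕ} (ν : Fin N → ℝ) (t : ℝ) (x : RSpace N) : RSpace N :=
  WithLp.toLp 2 (fun i => t ^ ν i * x i)

/-- A group law on `ℝ^N` makes it a homogeneous group with dilation exponents `ν` if it is a
Lie group on `ℝ^N` (multiplication and inversion are `C^∞`), the exponents are positive, and
each dilation `D_t`, `t > 0`, is a group automorphism. (For `t > 0` the map `D_t` is a linear
bijection with inverse `D_{1/t}`, so being an automorphism means being multiplicative.) -/
structure IsHomogeneousGroup {N : ℕ} [Group (RSpace N)] (ν : Fin N → ℝ) : Prop where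
  contDiff_mul : ContDiff ℝ ∞ (fun z : RSpace N × RSpace N => z.1 * z.2)
  contDiff_inv : ContDiff ℝ ∞ (fun x : RSpace N => x⁻¹)
  exponent_pos : ∀ i, 0 < ν i
  dilation_mul : ∀ t : ℝ, 0 < t → ∀ x y : RSpace N,
    dilation ν t (x * y) = dilation ν t x * dilation ν t y

/-- The homogeneous dimension `Q = ν₁ + … + ν_N`. -/
def homogeneousDimension {N : ℕ} (ν : Fin N → ℝ) : ℝ := ∑ i, ν i

/-- A homogeneous quasi-norm: a continuous non-negative function that is symmetric, homogeneous
of degree one for the dilations, and vanishes exactly at the origin (which is the identity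
element, being the only fixed point of the dilations). No triangle inequality is required. -/
structure IsHomogeneousQuasiNorm {N : ℕ} [Group (RSpace N)] (ν : Fin N → ℝ)
    (q : RSpace N → ℝ) : Prop where
  continuous : Continuous q
  nonneg : ∀ x, 0 ≤ q x
  map_inv : ∀ x, q x⁻¹ = q x
  map_dilation : ∀ t : ℝ, 0 < t → ∀ x, q (dilation ν t x) = t * q x
  eq_zero_iff : ∀ x, q x = 0 ↔ x = 0

/-- The quasi-ball `B(x, R) = {y : |x⁻¹ y| < R}`. -/
def quasiBall {N : ℕ} [Group (RSpace N)] (q : RSpace N → ℝ) (x : RSpace N) (R : ℝ) :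
    Set (RSpace N) :=
  {y | q (x⁻¹ * y) < R}

/-- The Hardy-Littlewood maximal function
`M₀ u (x) = sup_{r > 0} |B(x, r)|⁻¹ ∫_{B(x, r)} |u (y)| dy`, with values in `[0, ∞]`. -/
def maximalOperator {N : ℕ} [Group (RSpace N)] (q : RSpace N → ℝ) (u : RSpace N → ℝ)
    (x : RSpace N) : ℝ≥0∞ :=
  ⨆ (r : ℝ) (_ : 0 < r), (volume (quasiBall q x r))⁻¹ * ∫⁻ y in quasiBall q x r, ‖u y‖ₑ

/-- The global Morrey norm
`(sup_x sup_{r > 0} r ^ (-lam) ∫_{B(x, r)} |f (y)| ^ p dy) ^ (1 / p)`, with values in `[0, ∞]`,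
for functions with values in `ℝ` or in `[0, ∞]`. -/
def morreyNorm {N : ℕ} [Group (RSpace N)] {E : Type*} [ENorm E] (q : RSpace N → ℝ)
    (p lam : ℝ) (f : RSpace N → E) : ℝ≥0∞ :=
  (⨆ (x : RSpace N) (r : ℝ) (_ : 0 < r),
    ENNReal.ofReal (r ^ (-lam)) * ∫⁻ y in quasiBall q x r, ‖f y‖ₑ ^ p) ^ (1 / p)

/-- Membership in the global Morrey space: `f` is a real function in `L^p_loc` whose global Morrey
norm is finite. -/
def MemMorrey {N : ℕ} [Group (RSpace N)] (q : RSpace N → ℝ) (p lam : ℝ)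
    (f : RSpace N → ℝ) : Prop :=
  (∀ K : Set (RSpace N), IsCompact K → MemLp f (ENNReal.ofReal p) (volume.restrict K)) ∧
    morreyNorm q p lam f < ⊤

end

/-! The geometry reduces to two facts. Left translations have Jacobian determinant one, so `|B(x,
r)| = c r ^ Q` with `0 < c < ∞` (`volume_quasiBall`); and compactness of the unit quasi-ball
together with homogeneity gives a quasi-triangle inequality with some constant `K`
(`exists_quasiTriangle`). A Vitali covering then yields the weak type `(1, 1)` bound, and truncation
at half height with the layer cake formula yields the `L^p` bound
(`exists_strongType_maximalFunction`).

For the Morrey bound, write `Λ` for the norm of `g`, fix `B(x₀, R)` and take `x` in it. Averages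
over `B(x, r)` with `r ≤ R` only see `g` on `B(x₀, K R)`; the `L^p` bound for this truncation
contributes a multiple of `(K R) ^ λ Λ ^ p`. For `r ≥ R`, Jensen's inequality bounds the `p`-th
power of the average by `c⁻¹ r ^ (λ - Q) Λ ^ p`, which is at most `c⁻¹ R ^ (λ - Q) Λ ^ p` because `λ
< Q`; integrated over `B(x₀, R)`, of volume `c R ^ Q`, this contributes `R ^ λ Λ ^ p`. See
`maximalFunction_rpow_le_of_mem_quasiBall`. -/

open Filter Topology Set

/-! ### Dilations and their effect on volume. -/

section Dilation

variable {N : ℕ} {ν : Fin N → ℝ}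

@[simp] lemma dilation_apply (t : ℝ) (x : RSpace N) (i : Fin N) :
    dilation ν t x i = t ^ ν i * x i := rfl

lemma dilation_one (x : RSpace N) : dilation ν 1 x = x := by
  ext i; simp

lemma dilation_dilation {s t : ℝ} (hs : 0 ≤ s) (ht : 0 ≤ t) (x : RSpace N) :
    dilation ν s (dilation ν t x) = dilation ν (s * t) x := by
  ext i; simp [Real.mul_rpow hs ht, mul_assoc]

lemma dilation_dilation_inv {t : ℝ} (ht : 0 < t) (x : RSpace N) :
    dilation ν t (dilation ν t⁻¹ x) = x := by
  rw [dilation_dilation ht.le (inv_nonneg.2 ht.le), mul_inv_cancel₀ ht.ne', dilation_one]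

@[simp] lemma dilation_zero_right (t : ℝ) : dilation ν t (0 : RSpace N) = 0 := by
  ext i; simp

lemma dilation_zero_left (hν : ∀ i, 0 < ν i) (x : RSpace N) : dilation ν 0 x = 0 := by
  ext i; simp [Real.zero_rpow (hν i).ne']

lemma continuous_dilation_left (hν : ∀ i, 0 < ν i) (x : RSpace N) :
    Continuous fun t : ℝ => dilation ν t x := by
  unfold dilation
  refine (PiLp.continuous_toLp 2 _).comp (continuous_pi fun i => ?_)
  exact (Real.continuous_rpow_const (hν i).le).mul continuous_const

/-- The dilation as a linear map. -/
noncomputable def dilationLinear (ν : Fin N → ℝ) (t : ℝ) : RSpace N →ₗ[ℝ] RSpace N :=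
  Matrix.toLpLin 2 2 (Matrix.diagonal fun i => t ^ ν i)

lemma dilationLinear_apply (t : ℝ) (x : RSpace N) : dilationLinear ν t x = dilation ν t x := by
  ext i; simp [dilationLinear, Matrix.mulVec_diagonal]

lemma det_dilationLinear {t : ℝ} (ht : 0 < t) :
    LinearMap.det (dilationLinear ν t) = t ^ homogeneousDimension ν := by
  rw [dilationLinear, LinearMap.det_toLpLin, Matrix.det_diagonal, homogeneousDimension,
    Real.rpow_sum_of_pos ht]

/-- The dilation as a continuous linear map. -/
noncomputable def dilationCLM (ν : Fin N → ℝ) (t : ℝ) : RSpace N →L[ℝ] RSpace N :=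
  LinearMap.toContinuousLinearMap (dilationLinear ν t)

lemma coe_dilationCLM (t : ℝ) : ⇑(dilationCLM ν t) = dilation ν t := by
  ext1 x; exact dilationLinear_apply t x

lemma det_dilationCLM {t : ℝ} (ht : 0 < t) :
    (dilationCLM ν t).det = t ^ homogeneousDimension ν := by
  rw [← det_dilationLinear ht]; rfl

lemma continuous_dilation (t : ℝ) : Continuous (dilation ν t : RSpace N → RSpace N) := by
  rw [← coe_dilationCLM]; exact (dilationCLM ν t).continuous

lemma volume_preimage_dilation {t : ℝ} (ht : 0 < t) (s : Set (RSpace N)) :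
    volume (dilation ν t ⁻¹' s) = ENNReal.ofReal (t ^ homogeneousDimension ν)⁻¹ * volume s := by
  have hpos := Real.rpow_pos_of_pos ht (homogeneousDimension ν)
  have h := Measure.addHaar_preimage_linearMap (volume : Measure (RSpace N))
    (f := dilationLinear ν t) (by rw [det_dilationLinear ht]; exact hpos.ne') s
  rw [det_dilationLinear ht, abs_of_pos (inv_pos.2 hpos)] at h
  rw [← h]
  congr 1
  ext x; simp [dilationLinear_apply]

end Dilation

/-! ### Left invariance of Lebesgue measure. -/

namespace IsHomogeneousGroup

variable {N : ℕ} [Group (RSpace N)] {ν : Fin N → ℝ}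

/-- The identity is fixed by `D_2`, and `2 ^ ν i > 1` forces every coordinate of a fixed point to
vanish. -/
lemma one_eq_zero (hG : IsHomogeneousGroup ν) : (1 : RSpace N) = 0 := by
  have h : dilation ν 2 (1 : RSpace N) = 1 := by
    have := hG.dilation_mul 2 two_pos 1 1
    rwa [one_mul, left_eq_mul] at this
  ext i
  have hi := congrArg (fun x : RSpace N => x i) h
  simp only [dilation_apply] at hi
  have h2 : (1 : ℝ) < 2 ^ ν i := Real.one_lt_rpow one_lt_two (hG.exponent_pos i)
  have h3 : ((2 : ℝ) ^ ν i - 1) * (1 : RSpace N) i = 0 := by linarith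
  simpa using (mul_eq_zero.1 h3).resolve_left (by linarith)

lemma zero_mul_eq (hG : IsHomogeneousGroup ν) (x : RSpace N) : (0 : RSpace N) * x = x := by
  rw [← hG.one_eq_zero, one_mul]

lemma mul_zero_eq (hG : IsHomogeneousGroup ν) (x : RSpace N) : x * (0 : RSpace N) = x := by
  rw [← hG.one_eq_zero, mul_one]

lemma continuous_mul (hG : IsHomogeneousGroup ν) :
    Continuous fun z : RSpace N × RSpace N => z.1 * z.2 :=
  hG.contDiff_mul.continuous

lemma continuous_inv (hG : IsHomogeneousGroup ν) : Continuous fun x : RSpace N => x⁻¹ :=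
  hG.contDiff_inv.continuous

/-- The derivative of the left translation by `x` at `y`. -/
lemma hasFDerivAt_mul_left (hG : IsHomogeneousGroup ν) (x y : RSpace N) :
    HasFDerivAt (fun y => x * y)
      ((fderiv ℝ (fun z : RSpace N × RSpace N => z.1 * z.2) (x, y)).comp
        (ContinuousLinearMap.inr ℝ (RSpace N) (RSpace N))) y := by
  have h1 : HasFDerivAt (fun z : RSpace N × RSpace N => z.1 * z.2) _ (x, y) :=
    (hG.contDiff_mul.differentiable (by simp) (x, y)).hasFDerivAt
  exact h1.comp y (hasFDerivAt_prodMk_right x y)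

lemma differentiableAt_mul_left (hG : IsHomogeneousGroup ν) (x y : RSpace N) :
    DifferentiableAt ℝ (fun y => x * y) y :=
  (hG.hasFDerivAt_mul_left x y).differentiableAt

lemma continuous_det_fderiv_mul_left (hG : IsHomogeneousGroup ν) (y : RSpace N) :
    Continuous fun x : RSpace N => (fderiv ℝ (fun y => x * y) y).det := by
  simp_rw [fun x => (hG.hasFDerivAt_mul_left x y).fderiv]
  refine ContinuousLinearMap.continuous_det.comp ?_
  have h := hG.contDiff_mul.continuous_fderiv (by simp)
  exact (h.comp (Continuous.prodMk continuous_id continuous_const)).clm_comp continuous_const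

/-- Differentiating `D_t (x y) = D_t x · D_t y` in `y` at the origin puts one factor `det D_t` on
each side, and these cancel. -/
lemma det_fderiv_mul_left_dilation (hG : IsHomogeneousGroup ν) {t : ℝ} (ht : 0 < t)
    (x : RSpace N) :
    (fderiv ℝ (fun y => dilation ν t x * y) 0).det = (fderiv ℝ (fun y => x * y) 0).det := by
  have hD : ∀ y, HasFDerivAt (dilation ν t) (dilationCLM ν t) y := fun y => by
    rw [← coe_dilationCLM]; exact (dilationCLM ν t).hasFDerivAt
  have h1 : HasFDerivAt (fun y => dilation ν t (x * y)) _ 0 :=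
    (hD (x * 0)).comp 0 (hG.differentiableAt_mul_left x 0).hasFDerivAt
  have h2 : HasFDerivAt (fun y => dilation ν t x * dilation ν t y) _ 0 :=
    HasFDerivAt.comp (g := fun y => dilation ν t x * y) (0 : RSpace N)
      (by rw [dilation_zero_right]
          exact (hG.differentiableAt_mul_left (dilation ν t x) 0).hasFDerivAt) (hD 0)
  have h3 := congrArg ContinuousLinearMap.det (h1.unique (by
    simpa only [hG.dilation_mul t ht] using h2))
  have hmul : ∀ A B : RSpace N →L[ℝ] RSpace N, (A.comp B).det = A.det * B.det := fun A B =>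
    LinearMap.det_comp (A : RSpace N →ₗ[ℝ] RSpace N) B
  rw [hmul, hmul, det_dilationCLM ht, mul_comm] at h3
  exact (mul_right_cancel₀ (Real.rpow_pos_of_pos ht _).ne' h3).symm

/-- The determinant is constant along the orbit `t ↦ D_t x`, `t > 0`, and continuous up to `t = 0`,
where the orbit reaches the identity. -/
lemma det_fderiv_mul_left_zero (hG : IsHomogeneousGroup ν) (x : RSpace N) :
    (fderiv ℝ (fun y => x * y) 0).det = 1 := by
  have hc : Continuous fun t : ℝ => (fderiv ℝ (fun y => dilation ν t x * y) 0).det :=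
    (hG.continuous_det_fderiv_mul_left 0).comp (continuous_dilation_left hG.exponent_pos x)
  have h0 : (fderiv ℝ (fun y => dilation ν 0 x * y) 0).det = 1 := by
    simp_rw [dilation_zero_left hG.exponent_pos, hG.zero_mul_eq]
    rw [fderiv_fun_id]; simp [ContinuousLinearMap.det]
  have hlim := (hc.tendsto 0).mono_left (nhdsWithin_le_nhds (s := Ioi 0))
  simp only [h0] at hlim
  refine tendsto_nhds_unique (tendsto_const_nhds.congr' ?_) hlim
  filter_upwards [self_mem_nhdsWithin] with t ht
  exact (hG.det_fderiv_mul_left_dilation ht x).symm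

/-- Left translations of a homogeneous group have Jacobian determinant one. -/
lemma det_fderiv_mul_left (hG : IsHomogeneousGroup ν) (x y : RSpace N) :
    (fderiv ℝ (fun y => x * y) y).det = 1 := by
  -- Associativity and the chain rule carry the determinant from the origin to `y`.
  have h1 : HasFDerivAt (fun z => x * (y * z)) _ 0 :=
    HasFDerivAt.comp (g := fun z => x * z) (0 : RSpace N)
      (by rw [hG.mul_zero_eq]; exact (hG.differentiableAt_mul_left x y).hasFDerivAt)
      (hG.differentiableAt_mul_left y 0).hasFDerivAt
  have h2 := (hG.differentiableAt_mul_left (x * y) 0).hasFDerivAt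
  rw [show (fun z => x * (y * z)) = fun z => x * y * z from
    funext fun z => (mul_assoc x y z).symm] at h1
  have h3 := congrArg ContinuousLinearMap.det (h1.unique h2)
  have hmul : ∀ A B : RSpace N →L[ℝ] RSpace N, (A.comp B).det = A.det * B.det := fun A B =>
    LinearMap.det_comp (A : RSpace N →ₗ[ℝ] RSpace N) B
  rw [hmul, hG.det_fderiv_mul_left_zero, hG.det_fderiv_mul_left_zero, mul_one] at h3
  exact h3

/-- Lebesgue measure is left invariant. -/
lemma volume_image_mul_left (hG : IsHomogeneousGroup ν) (x : RSpace N) {s : Set (RSpace N)}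
    (hs : MeasurableSet s) : volume ((fun y => x * y) '' s) = volume s := by
  rw [← lintegral_abs_det_fderiv_eq_addHaar_image volume hs
    (fun y _ => (hG.differentiableAt_mul_left x y).hasFDerivAt.hasFDerivWithinAt)
    (mul_right_injective x).injOn]
  simp [hG.det_fderiv_mul_left]

end IsHomogeneousGroup

/-! ### Quasi-balls: volume, compactness, quasi-triangle inequality. -/

section QuasiBall

variable {N : ℕ} [Group (RSpace N)] {ν : Fin N → ℝ} {q : RSpace N → ℝ}

lemma IsHomogeneousQuasiNorm.map_zero (hq : IsHomogeneousQuasiNorm ν q) : q 0 = 0 :=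
  (hq.eq_zero_iff 0).2 rfl

lemma isOpen_setOf_quasiBall (hG : IsHomogeneousGroup ν) (hq : IsHomogeneousQuasiNorm ν q)
    (r : ℝ) : IsOpen {z : RSpace N × RSpace N | z.2 ∈ quasiBall q z.1 r} := by
  refine isOpen_lt (hq.continuous.comp ?_) continuous_const
  exact hG.continuous_mul.comp ((hG.continuous_inv.comp continuous_fst).prodMk continuous_snd)

lemma isOpen_quasiBall (hG : IsHomogeneousGroup ν) (hq : IsHomogeneousQuasiNorm ν q)
    (x : RSpace N) (r : ℝ) : IsOpen (quasiBall q x r) :=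
  (isOpen_setOf_quasiBall hG hq r).preimage (Continuous.prodMk_right x)

lemma measurableSet_quasiBall (hG : IsHomogeneousGroup ν) (hq : IsHomogeneousQuasiNorm ν q)
    (x : RSpace N) (r : ℝ) : MeasurableSet (quasiBall q x r) :=
  (isOpen_quasiBall hG hq x r).measurableSet

lemma mem_quasiBall_self (hG : IsHomogeneousGroup ν) (hq : IsHomogeneousQuasiNorm ν q)
    (x : RSpace N) {r : ℝ} (hr : 0 < r) : x ∈ quasiBall q x r := by
  simpa [quasiBall, hG.one_eq_zero, hq.map_zero] using hr

lemma mem_quasiBall_comm (hq : IsHomogeneousQuasiNorm ν q) {x y : RSpace N} {r : ℝ} :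
    y ∈ quasiBall q x r ↔ x ∈ quasiBall q y r := by
  simp only [quasiBall, mem_ofPred_eq]
  rw [← hq.map_inv (x⁻¹ * y), mul_inv_rev, inv_inv]

lemma quasiBall_one (r : ℝ) : quasiBall q (1 : RSpace N) r = {y | q y < r} := by
  simp [quasiBall]

/-- `B(x, r)` is the left translate by `x` of `D_r B(1, 1)`. -/
lemma volume_quasiBall (hG : IsHomogeneousGroup ν) (hq : IsHomogeneousQuasiNorm ν q)
    (x : RSpace N) {r : ℝ} (hr : 0 < r) :
    volume (quasiBall q x r) =
      ENNReal.ofReal (r ^ homogeneousDimension ν) * volume (quasiBall q (1 : RSpace N) 1) := by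
  have h1 : quasiBall q x r = (fun y => x * y) '' quasiBall q 1 r := by
    ext y
    simp only [quasiBall, mem_ofPred_eq, inv_one, one_mul, mem_image]
    exact ⟨fun h => ⟨x⁻¹ * y, h, by simp⟩, by rintro ⟨z, hz, rfl⟩; simpa using hz⟩
  have h2 : quasiBall q (1 : RSpace N) r = dilation ν r⁻¹ ⁻¹' quasiBall q 1 1 := by
    ext y
    simp only [quasiBall_one, mem_preimage, mem_ofPred_eq, hq.map_dilation _ (inv_pos.2 hr)]
    rw [inv_mul_lt_iff₀ hr, mul_one]
  rw [h1, hG.volume_image_mul_left x (measurableSet_quasiBall hG hq 1 r), h2,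
    volume_preimage_dilation (inv_pos.2 hr), Real.inv_rpow hr.le, inv_inv]

/-- Let `c > 0` bound `q` from below on the Euclidean unit sphere. If `‖x‖ > 1`, the orbit `D_t x`
meets the sphere at some `t ≤ 1`, so `c ≤ t q x ≤ q x`. Hence `q < c` forces `‖x‖ ≤ 1`, and dilation
carries this to every level. -/
lemma isCompact_setOf_quasiNorm_le (hG : IsHomogeneousGroup ν)
    (hq : IsHomogeneousQuasiNorm ν q) (r : ℝ) : IsCompact {x : RSpace N | q x ≤ r} := by
  obtain ⟨c, hc, hcS⟩ : ∃ c > 0, ∀ x : RSpace N, ‖x‖ = 1 → c ≤ q x := by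
    -- The sphere is empty when `N = 0`; any `c` then serves.
    rcases (Metric.sphere (0 : RSpace N) 1).eq_empty_or_nonempty with he | hne
    · refine ⟨1, one_pos, fun x hx => ?_⟩
      exact absurd (show x ∈ Metric.sphere (0 : RSpace N) 1 by simpa using hx) (by simp [he])
    · obtain ⟨x₀, hx₀, hmin⟩ := (isCompact_sphere (0 : RSpace N) 1).exists_isMinOn hne
        hq.continuous.continuousOn
      refine ⟨q x₀, (hq.nonneg x₀).lt_of_ne fun h => ?_, fun x hx => hmin (by simpa using hx)⟩
      rw [(hq.eq_zero_iff x₀).1 h.symm] at hx₀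
      simp at hx₀
  have hball : ∀ x : RSpace N, q x < c → ‖x‖ ≤ 1 := by
    intro x hx
    by_contra! h
    have hcont : ContinuousOn (fun t : ℝ => ‖dilation ν t x‖) (Icc 0 1) :=
      (continuous_dilation_left hG.exponent_pos x).norm.continuousOn
    obtain ⟨t, ht, ht1⟩ := intermediate_value_Icc zero_le_one hcont
      (show (1 : ℝ) ∈ Icc _ _ by
        simp only [dilation_zero_left hG.exponent_pos, dilation_one, norm_zero]
        exact ⟨zero_le_one, h.le⟩)
    have ht0 : 0 < t := ht.1.lt_of_ne (by
      rintro rfl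
      simp [dilation_zero_left hG.exponent_pos] at ht1)
    have := hcS _ ht1
    rw [hq.map_dilation t ht0] at this
    nlinarith [ht.2, hq.nonneg x]
  -- With this `s`, `q x ≤ r` gives `q (D_{1/s} x) < c`; the `+ 1` makes `s` positive and the
  -- inequality strict.
  set s : ℝ := (|r| + 1) / c with hs
  have hs0 : 0 < s := by positivity
  refine ((isCompact_closedBall (0 : RSpace N) 1).image
    (continuous_dilation (ν := ν) s)).of_isClosed_subset
    (isClosed_le hq.continuous continuous_const) fun x hx => ?_
  refine ⟨dilation ν s⁻¹ x, ?_, dilation_dilation_inv hs0 x⟩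
  simp only [Metric.mem_closedBall, dist_zero_right]
  apply hball
  rw [hq.map_dilation _ (inv_pos.2 hs0), inv_mul_lt_iff₀ hs0, hs, div_mul_cancel₀ _ hc.ne']
  have : q x ≤ r := hx
  linarith [le_abs_self r]

lemma volume_quasiBall_one_lt_top (hG : IsHomogeneousGroup ν)
    (hq : IsHomogeneousQuasiNorm ν q) : volume (quasiBall q (1 : RSpace N) 1) < ⊤ := by
  refine (measure_mono fun x hx => ?_).trans_lt
    (isCompact_setOf_quasiNorm_le hG hq 1).measure_lt_top
  rw [quasiBall_one] at hx
  exact le_of_lt (show q x < 1 from hx)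

lemma volume_quasiBall_one_ne_zero (hG : IsHomogeneousGroup ν)
    (hq : IsHomogeneousQuasiNorm ν q) : volume (quasiBall q (1 : RSpace N) 1) ≠ 0 :=
  ((isOpen_quasiBall hG hq 1 1).measure_pos volume
    ⟨1, mem_quasiBall_self hG hq 1 one_pos⟩).ne'

lemma volume_quasiBall_ne_top (hG : IsHomogeneousGroup ν) (hq : IsHomogeneousQuasiNorm ν q)
    (x : RSpace N) {r : ℝ} (hr : 0 < r) : volume (quasiBall q x r) ≠ ⊤ := by
  rw [volume_quasiBall hG hq x hr]
  exact ENNReal.mul_ne_top ENNReal.ofReal_ne_top (volume_quasiBall_one_lt_top hG hq).ne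

lemma volume_quasiBall_ne_zero (hG : IsHomogeneousGroup ν) (hq : IsHomogeneousQuasiNorm ν q)
    (x : RSpace N) {r : ℝ} (hr : 0 < r) : volume (quasiBall q x r) ≠ 0 :=
  ((isOpen_quasiBall hG hq x r).measure_pos volume ⟨x, mem_quasiBall_self hG hq x hr⟩).ne'

/-- The quasi-triangle inequality, for balls. -/
lemma exists_quasiTriangle (hG : IsHomogeneousGroup ν) (hq : IsHomogeneousQuasiNorm ν q) :
    ∃ K : ℝ, 1 ≤ K ∧ ∀ x y z : RSpace N, ∀ r : ℝ, 0 < r →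
      y ∈ quasiBall q x r → z ∈ quasiBall q y r → z ∈ quasiBall q x (K * r) := by
  -- `q (a * b)` is bounded on the compact set `q a ≤ 1`, `q b ≤ 1`; rescaling by `r⁻¹` reduces the
  -- general case to this one.
  have hcomp := (isCompact_setOf_quasiNorm_le hG hq 1).prod
    (isCompact_setOf_quasiNorm_le hG hq 1)
  obtain ⟨M, hM⟩ := (hcomp.image (hq.continuous.comp hG.continuous_mul)).bddAbove
  refine ⟨max M 0 + 1, by linarith [le_max_right M 0], fun x y z r hr hy hz => ?_⟩
  have hr' := inv_pos.2 hr
  have hle : ∀ w : RSpace N, q w < r → q (dilation ν r⁻¹ w) ≤ 1 := fun w hw => by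
    rw [hq.map_dilation _ hr', inv_mul_le_iff₀ hr, mul_one]; exact hw.le
  have h := hM ⟨(dilation ν r⁻¹ (x⁻¹ * y), dilation ν r⁻¹ (y⁻¹ * z)),
    ⟨hle _ hy, hle _ hz⟩, rfl⟩
  simp only [Function.comp_apply] at h
  rw [← hG.dilation_mul _ hr', hq.map_dilation _ hr', inv_mul_le_iff₀ hr, mul_assoc,
    mul_inv_cancel_left] at h
  change q (x⁻¹ * z) < _
  nlinarith [le_max_left M 0]

lemma quasiBall_mono {x : RSpace N} {r s : ℝ} (h : r ≤ s) : quasiBall q x r ⊆ quasiBall q x s :=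
  fun _ hy => lt_of_lt_of_le hy h

end QuasiBall

/-! ### The layer cake formula in `[0, ∞]`. -/

section LayerCake

lemma ENNReal.rpow_eq_lintegral_indicator (a : ℝ≥0∞) {p : ℝ} (hp : 0 < p) :
    a ^ p = ENNReal.ofReal p * ∫⁻ t in Ioi (0 : ℝ),
      {t : ℝ | ENNReal.ofReal t < a}.indicator (fun t => ENNReal.ofReal (t ^ (p - 1))) t := by
  have hfin : ∀ b : ℝ, 0 ≤ b → ENNReal.ofReal b ^ p = ENNReal.ofReal p * ∫⁻ t in Ioi (0 : ℝ),
      {t : ℝ | ENNReal.ofReal t < ENNReal.ofReal b}.indicator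
        (fun t => ENNReal.ofReal (t ^ (p - 1))) t := by
    intro b hb
    -- The real-valued layer cake formula for a point mass gives `b ^ p = p ∫₀ᵇ t ^ (p - 1) dt`.
    have h := lintegral_rpow_eq_lintegral_meas_lt_mul (Measure.dirac ()) (f := fun _ => b)
      (ae_of_all _ fun _ => hb) aemeasurable_const hp
    rw [lintegral_dirac, ← ENNReal.ofReal_rpow_of_nonneg hb hp.le] at h
    rw [h]
    congr 1
    refine setLIntegral_congr_fun measurableSet_Ioi fun t ht => ?_
    have ht' : (0 : ℝ) ≤ t := le_of_lt ht
    by_cases hlt : t < b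
    · simp [indicator, hlt, ENNReal.ofReal_lt_ofReal_iff_of_nonneg ht']
    · simp [indicator, hlt, ENNReal.ofReal_lt_ofReal_iff_of_nonneg ht']
  rcases eq_or_ne a ⊤ with rfl | ha
  · rw [ENNReal.top_rpow_of_pos hp]
    symm
    -- By monotonicity in `a`, the right side at `a = ∞` dominates `b ^ p` for every finite `b`.
    refine ENNReal.eq_top_of_forall_nnreal_le fun c => ?_
    have hc : (c : ℝ≥0∞) = ENNReal.ofReal ((c : ℝ) ^ p⁻¹) ^ p := by
      rw [ENNReal.ofReal_rpow_of_nonneg (by positivity) hp.le, Real.rpow_inv_rpow c.coe_nonneg hp.ne',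
        ENNReal.ofReal_coe_nnreal]
    rw [hc, hfin _ (by positivity)]
    gcongr
    exact le_top
  · rw [← ENNReal.ofReal_toReal ha]
    exact hfin _ ENNReal.toReal_nonneg

/-- The layer cake formula for powers of functions with values in `[0, ∞]`. -/
lemma MeasureTheory.lintegral_ennreal_rpow_eq {α : Type*} [MeasurableSpace α] (μ : Measure α)
    [SFinite μ] {f : α → ℝ≥0∞} (hf : Measurable f) {p : ℝ} (hp : 0 < p) :
    ∫⁻ x, f x ^ p ∂μ = ENNReal.ofReal p * ∫⁻ t in Ioi (0 : ℝ),
      μ {x | ENNReal.ofReal t < f x} * ENNReal.ofReal (t ^ (p - 1)) := by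
  simp_rw [fun x => ENNReal.rpow_eq_lintegral_indicator (f x) hp]
  have hset : MeasurableSet {z : α × ℝ | ENNReal.ofReal z.2 < f z.1} :=
    measurableSet_lt (ENNReal.measurable_ofReal.comp measurable_snd) (hf.comp measurable_fst)
  rw [lintegral_const_mul' _ _ ENNReal.ofReal_ne_top, lintegral_lintegral_swap]
  · congr 1
    refine lintegral_congr fun t => ?_
    have hm : MeasurableSet {x | ENNReal.ofReal t < f x} :=
      measurableSet_lt measurable_const hf
    rw [mul_comm, ← lintegral_indicator_const hm]
    rfl
  · have hm : Measurable ({z : α × ℝ | ENNReal.ofReal z.2 < f z.1}.indicator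
        fun z => ENNReal.ofReal (z.2 ^ (p - 1))) :=
      Measurable.indicator (by fun_prop) hset
    exact hm.aemeasurable

end LayerCake

/-! ### Weak and strong type bounds for the maximal function. -/

section Maximal

variable {N : ℕ} [Group (RSpace N)] {ν : Fin N → ℝ} {q : RSpace N → ℝ}

/-- The maximal function of a function with values in `[0, ∞]`. -/
noncomputable def maximalFunction (q : RSpace N → ℝ) (g : RSpace N → ℝ≥0∞) (x : RSpace N) :
    ℝ≥0∞ :=
  ⨆ (r : ℝ) (_ : 0 < r), (volume (quasiBall q x r))⁻¹ * ∫⁻ y in quasiBall q x r, g y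

lemma le_maximalFunction (g : RSpace N → ℝ≥0∞) (x : RSpace N) {r : ℝ} (hr : 0 < r) :
    (volume (quasiBall q x r))⁻¹ * ∫⁻ y in quasiBall q x r, g y ≤ maximalFunction q g x :=
  le_iSup₂ (f := fun (r : ℝ) (_ : 0 < r) =>
    (volume (quasiBall q x r))⁻¹ * ∫⁻ y in quasiBall q x r, g y) r hr

lemma maximalFunction_congr_ae {g h : RSpace N → ℝ≥0∞} (hgh : g =ᵐ[volume] h) :
    maximalFunction q g = maximalFunction q h := by
  ext x
  refine iSup_congr fun r => iSup_congr fun _ => ?_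
  rw [lintegral_congr_ae (ae_restrict_of_ae hgh)]

/-- Needed for measurability. `B(x, r)` is the increasing union of `B(x, s)` over rational `0 < s <
r`, and replacing `|B(x, r)|⁻¹` by `|B(x, s)|⁻¹` only enlarges the average. -/
lemma maximalFunction_eq_iSup_rat (g : RSpace N → ℝ≥0∞) (x : RSpace N) :
    maximalFunction q g x = ⨆ r : {r : ℚ // 0 < r},
      (volume (quasiBall q x r))⁻¹ * ∫⁻ y in quasiBall q x r, g y := by
  apply le_antisymm
  · refine iSup₂_le fun r hr => ?_
    have hU : quasiBall q x r = ⋃ s : {s : ℚ // 0 < s ∧ (s : ℝ) < r}, quasiBall q x s := by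
      ext y
      simp only [mem_iUnion]
      refine ⟨fun hy => ?_, fun ⟨s, hs⟩ => quasiBall_mono s.2.2.le hs⟩
      obtain ⟨s, hs1, hs2⟩ := exists_rat_btwn (max_lt (show q (x⁻¹ * y) < r from hy) hr)
      exact ⟨⟨s, by exact_mod_cast (le_max_right _ _).trans_lt hs1, hs2⟩,
        (le_max_left _ _).trans_lt hs1⟩
    have hd : Directed (· ⊆ ·) fun s : {s : ℚ // 0 < s ∧ (s : ℝ) < r} => quasiBall q x s :=
      Monotone.directed_le fun a b hab => quasiBall_mono (by exact_mod_cast hab)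
    have hI : ∫⁻ y in quasiBall q x r, g y =
        ⨆ s : {s : ℚ // 0 < s ∧ (s : ℝ) < r}, ∫⁻ y in quasiBall q x s, g y := by
      conv_lhs => rw [hU]
      exact setLIntegral_iUnion_of_directed g hd
    rw [hI, ENNReal.mul_iSup]
    refine iSup_le fun s => ?_
    refine le_trans ?_ (le_iSup (fun r : {r : ℚ // 0 < r} =>
      (volume (quasiBall q x r))⁻¹ * ∫⁻ y in quasiBall q x r, g y) ⟨s, s.2.1⟩)
    gcongr
    exact quasiBall_mono s.2.2.le
  · exact iSup_le fun r => le_maximalFunction g x (by exact_mod_cast r.2)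

lemma measurable_setLIntegral_quasiBall (hG : IsHomogeneousGroup ν)
    (hq : IsHomogeneousQuasiNorm ν q) {g : RSpace N → ℝ≥0∞} (hg : Measurable g) (r : ℝ) :
    Measurable fun x => ∫⁻ y in quasiBall q x r, g y := by
  have h : Measurable ({z : RSpace N × RSpace N | z.2 ∈ quasiBall q z.1 r}.indicator
      fun z => g z.2) :=
    (hg.comp measurable_snd).indicator (isOpen_setOf_quasiBall hG hq r).measurableSet
  have h' : Measurable fun x => ∫⁻ y, (quasiBall q x r).indicator g y :=
    Measurable.lintegral_prod_right (f := fun x y => (quasiBall q x r).indicator g y) h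
  rwa [funext fun x => lintegral_indicator (measurableSet_quasiBall hG hq x r) g] at h'

lemma measurable_maximalFunction (hG : IsHomogeneousGroup ν)
    (hq : IsHomogeneousQuasiNorm ν q) {g : RSpace N → ℝ≥0∞} (hg : Measurable g) :
    Measurable (maximalFunction q g) := by
  rw [funext (maximalFunction_eq_iSup_rat g)]
  refine Measurable.iSup fun r => ?_
  have hr : (0 : ℝ) < (r : ℚ) := by exact_mod_cast r.2
  simp_rw [fun x => volume_quasiBall hG hq x hr]
  exact (measurable_setLIntegral_quasiBall hG hq hg r).const_mul _

lemma mul_volume_le_of_lt_average (hG : IsHomogeneousGroup ν)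
    (hq : IsHomogeneousQuasiNorm ν q) {x : RSpace N} {r : ℝ} (hr : 0 < r) {s I : ℝ≥0∞}
    (h : s ≤ (volume (quasiBall q x r))⁻¹ * I) : s * volume (quasiBall q x r) ≤ I := by
  rwa [mul_comm _ I, ← div_eq_mul_inv,
    ENNReal.le_div_iff_mul_le (.inl (volume_quasiBall_ne_zero hG hq x hr))
      (.inl (volume_quasiBall_ne_top hG hq x hr))] at h

/-- The weak type `(1, 1)` inequality. -/
lemma exists_weakType_maximalFunction (hG : IsHomogeneousGroup ν)
    (hq : IsHomogeneousQuasiNorm ν q) (hQ : 0 < homogeneousDimension ν) :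
    ∃ A : ℝ≥0∞, A ≠ ⊤ ∧ ∀ (g : RSpace N → ℝ≥0∞) (s : ℝ≥0∞), s ≠ 0 →
      s * volume {x | s < maximalFunction q g x} ≤ A * ∫⁻ y, g y := by
  obtain ⟨K, hK, htri⟩ := exists_quasiTriangle hG hq
  have hA : 0 < (2 * K) ^ homogeneousDimension ν := by positivity
  refine ⟨ENNReal.ofReal ((2 * K) ^ homogeneousDimension ν), ENNReal.ofReal_ne_top,
    fun g s hs => ?_⟩
  set Q := homogeneousDimension ν
  set c := volume (quasiBall q (1 : RSpace N) 1)
  have hc0 : c ≠ 0 := volume_quasiBall_one_ne_zero hG hq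
  rcases eq_or_ne (∫⁻ y, g y) ⊤ with hI | hI
  · rw [hI, ENNReal.mul_top (by simpa using hA)]; exact le_top
  set t := {x | s < maximalFunction q g x}
  -- Each point of `t` receives a ball with average at least `s`; the radius `1` off `t` is a dummy.
  have hex : ∀ x : RSpace N, ∃ r : ℝ, 0 < r ∧ (x ∈ t →
      s * volume (quasiBall q x r) ≤ ∫⁻ y in quasiBall q x r, g y) := by
    intro x
    by_cases hx : x ∈ t
    · obtain ⟨r, hr⟩ := lt_iSup_iff.1 (show s < maximalFunction q g x from hx)
      obtain ⟨hr0, hr⟩ := lt_iSup_iff.1 hr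
      exact ⟨r, hr0, fun _ => mul_volume_le_of_lt_average hG hq hr0 hr.le⟩
    · exact ⟨1, one_pos, fun h => absurd h hx⟩
  choose ρ hρ0 hρ using hex
  -- The Vitali selection needs bounded radii: `s c (ρ x) ^ Q ≤ ∫ g < ∞`.
  have hbound : ∀ x ∈ t, ρ x ≤ ((∫⁻ y, g y) / (s * c)).toReal ^ Q⁻¹ := by
    intro x hx
    have h1 : s * volume (quasiBall q x (ρ x)) ≤ ∫⁻ y, g y :=
      (hρ x hx).trans (setLIntegral_le_lintegral _ _)
    have hs' : s ≠ ⊤ := (lt_of_lt_of_le (show s < maximalFunction q g x from hx) le_top).ne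
    have hc1 : c ≠ ⊤ := (volume_quasiBall_one_lt_top hG hq).ne
    rw [volume_quasiBall hG hq x (hρ0 x), mul_left_comm] at h1
    rw [← ENNReal.le_div_iff_mul_le (.inl (mul_ne_zero hs hc0))
      (.inl (ENNReal.mul_ne_top hs' hc1))] at h1
    have h2 := (ENNReal.ofReal_le_iff_le_toReal
      (ENNReal.div_ne_top hI (mul_ne_zero hs hc0))).1 h1
    exact (Real.le_rpow_inv_iff_of_pos (hρ0 x).le ENNReal.toReal_nonneg hQ).2 h2
  obtain ⟨u, hut, hdisj, hcov⟩ := Vitali.exists_disjoint_subfamily_covering_enlargement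
    (fun x => quasiBall q x (ρ x)) t ρ 2 one_lt_two (fun x _ => (hρ0 x).le) _ hbound
    (fun x _ => ⟨x, mem_quasiBall_self hG hq x (hρ0 x)⟩)
  have hcount : u.Countable := hdisj.countable_of_isOpen
    (fun x _ => isOpen_quasiBall hG hq x _)
    (fun x _ => ⟨x, mem_quasiBall_self hG hq x (hρ0 x)⟩)
  -- Only the centres must be covered. The ball at `x` meets a selected ball at `b` with `ρ x ≤ 2 ρ
  -- b`, so one use of the quasi-triangle inequality at scale `2 ρ b` suffices.
  have hsub : t ⊆ ⋃ b ∈ u, quasiBall q b (2 * K * ρ b) := by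
    intro x hx
    obtain ⟨b, hb, ⟨z, hzx, hzb⟩, hle⟩ := hcov x hx
    refine mem_iUnion₂.2 ⟨b, hb, ?_⟩
    rw [mul_comm 2 K, mul_assoc]
    refine htri b z x (2 * ρ b) (by linarith [hρ0 b])
      (quasiBall_mono (by linarith [hρ0 b]) hzb) ?_
    exact quasiBall_mono hle ((mem_quasiBall_comm hq).1 hzx)
  calc s * volume t ≤ s * ∑' b : u, volume (quasiBall q (b : RSpace N) (2 * K * ρ b)) := by
        gcongr
        exact (measure_mono hsub).trans (measure_biUnion_le _ hcount _)
    _ = ENNReal.ofReal ((2 * K) ^ Q) * ∑' b : u, s * volume (quasiBall q (b : RSpace N) (ρ b)) := by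
        rw [← ENNReal.tsum_mul_left, ← ENNReal.tsum_mul_left]
        refine tsum_congr fun b => ?_
        rw [volume_quasiBall hG hq _ (hρ0 b),
          volume_quasiBall hG hq _ (mul_pos (by positivity) (hρ0 b)),
          Real.mul_rpow (by positivity) (hρ0 b).le, ENNReal.ofReal_mul hA.le]
        ring
    _ ≤ ENNReal.ofReal ((2 * K) ^ Q) *
          ∑' b : u, ∫⁻ y in quasiBall q (b : RSpace N) (ρ b), g y := by
        gcongr with b
        exact hρ b (hut b.2)
    _ = ENNReal.ofReal ((2 * K) ^ Q) * ∫⁻ y in ⋃ b ∈ u, quasiBall q b (ρ b), g y := by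
        rw [lintegral_biUnion hcount (fun b _ => measurableSet_quasiBall hG hq b _) hdisj]
    _ ≤ _ := by
        grw [setLIntegral_le_lintegral]

/-- Pointwise `g ≤ g 1_{g > s} + s`, and averaging preserves constants. The weak type bound can thus
be applied to the large part of `g` alone. -/
lemma maximalFunction_le_indicator_add (hG : IsHomogeneousGroup ν)
    (hq : IsHomogeneousQuasiNorm ν q) (g : RSpace N → ℝ≥0∞) (s : ℝ≥0∞) (x : RSpace N) :
    maximalFunction q g x ≤ maximalFunction q ({y | s < g y}.indicator g) x + s := by
  refine iSup₂_le fun r hr => ?_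
  calc (volume (quasiBall q x r))⁻¹ * ∫⁻ y in quasiBall q x r, g y
      ≤ (volume (quasiBall q x r))⁻¹ *
        ∫⁻ y in quasiBall q x r, ({y | s < g y}.indicator g y + s) := by
        gcongr with y
        by_cases hy : s < g y
        · simp [indicator, hy]
        · exact (not_lt.1 hy).trans le_add_self
    _ = (volume (quasiBall q x r))⁻¹ *
          (∫⁻ y in quasiBall q x r, {y | s < g y}.indicator g y) + s := by
        rw [lintegral_add_right _ measurable_const, setLIntegral_const, mul_add, mul_left_comm,
          ENNReal.inv_mul_cancel (volume_quasiBall_ne_zero hG hq x hr)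
            (volume_quasiBall_ne_top hG hq x hr), mul_one]
    _ ≤ _ := by
        gcongr
        exact le_maximalFunction _ x hr

/-- The Hardy-Littlewood maximal theorem on `L^p`. -/
lemma exists_strongType_maximalFunction (hG : IsHomogeneousGroup ν)
    (hq : IsHomogeneousQuasiNorm ν q) (hQ : 0 < homogeneousDimension ν) {p : ℝ} (hp : 1 < p) :
    ∃ C : ℝ≥0∞, C ≠ ⊤ ∧ ∀ g : RSpace N → ℝ≥0∞, Measurable g →
      ∫⁻ x, maximalFunction q g x ^ p ≤ C * ∫⁻ x, g x ^ p := by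
  obtain ⟨A, hA, hweak⟩ := exists_weakType_maximalFunction hG hq hQ
  have hp1 : 0 < p - 1 := by linarith
  have hp0 : 0 < p := by linarith
  have hp1' : ENNReal.ofReal (p - 1) ≠ 0 := by simpa using hp
  refine ⟨ENNReal.ofReal p * (2 * A * ((ENNReal.ofReal (p - 1))⁻¹ * 2 ^ (p - 1))), by
    finiteness, fun g hg => ?_⟩
  -- Truncating at height `t / 2` bounds `|{M g > t}|` by `(2 A / t) ∫_{g > t/2} g`. That integral
  -- is the mass of `{2 g > t}` under the measure `g dx`, which prepares a second use of the layer
  -- cake formula.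
  have hlevel : ∀ t ∈ Ioi (0 : ℝ),
      volume {x | ENNReal.ofReal t < maximalFunction q g x} * ENNReal.ofReal (t ^ (p - 1)) ≤
        2 * A * (volume.withDensity g {x | ENNReal.ofReal t < 2 * g x} *
          ENNReal.ofReal (t ^ (p - 1 - 1))) := by
    intro t ht
    have ht0 : (0 : ℝ) < t := ht
    have hS : {x | ENNReal.ofReal t < 2 * g x} = {y | ENNReal.ofReal t / 2 < g y} := by
      ext y
      simp only [mem_ofPred_eq]
      rw [ENNReal.div_lt_iff (by simp) (by simp), mul_comm]
    have hmeas : MeasurableSet {y | ENNReal.ofReal t / 2 < g y} :=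
      measurableSet_lt measurable_const hg
    have h1 := hweak ({y | ENNReal.ofReal t / 2 < g y}.indicator g) (ENNReal.ofReal t / 2)
      (by simpa using ht0)
    rw [lintegral_indicator hmeas] at h1
    rw [hS, withDensity_apply _ hmeas]
    have h2 : volume {x | ENNReal.ofReal t < maximalFunction q g x} ≤ volume
        {x | ENNReal.ofReal t / 2 <
          maximalFunction q ({y | ENNReal.ofReal t / 2 < g y}.indicator g) x} := by
      refine measure_mono fun x hx => ?_
      simp only [mem_ofPred_eq] at hx ⊢
      by_contra! hle
      have h3 := (maximalFunction_le_indicator_add hG hq g (ENNReal.ofReal t / 2) x).trans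
        (add_le_add_left hle _)
      rw [ENNReal.add_halves] at h3
      exact absurd hx (not_lt.2 h3)
    have h4 : ENNReal.ofReal (t ^ (p - 1)) =
        2 * (ENNReal.ofReal t / 2) * ENNReal.ofReal (t ^ (p - 1 - 1)) := by
      rw [ENNReal.mul_div_cancel (by simp) (by simp), ← ENNReal.ofReal_mul ht0.le,
        Real.rpow_sub_one ht0.ne' (p - 1), mul_div_cancel₀ _ ht0.ne']
    calc _ ≤ volume {x | ENNReal.ofReal t / 2 <
          maximalFunction q ({y | ENNReal.ofReal t / 2 < g y}.indicator g) x} *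
          ENNReal.ofReal (t ^ (p - 1)) := by gcongr
      _ = 2 * ((ENNReal.ofReal t / 2) * volume {x | ENNReal.ofReal t / 2 <
          maximalFunction q ({y | ENNReal.ofReal t / 2 < g y}.indicator g) x}) *
          ENNReal.ofReal (t ^ (p - 1 - 1)) := by rw [h4]; ring
      _ ≤ 2 * (A * ∫⁻ y in {y | ENNReal.ofReal t / 2 < g y}, g y) *
          ENNReal.ofReal (t ^ (p - 1 - 1)) := by gcongr
      _ = _ := by ring
  -- The exponent drops to `p - 1`, which is positive because `p > 1`; this is where the factor `1 /
  -- (p - 1)` arises.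
  have h2 := lintegral_ennreal_rpow_eq (volume.withDensity g) (hg.const_mul 2) hp1
  rw [lintegral_ennreal_rpow_eq volume (measurable_maximalFunction hG hq hg) hp0]
  calc _ ≤ ENNReal.ofReal p * ∫⁻ t in Ioi (0 : ℝ),
        2 * A * (volume.withDensity g {x | ENNReal.ofReal t < 2 * g x} *
          ENNReal.ofReal (t ^ (p - 1 - 1))) := by
        gcongr 1
        exact setLIntegral_mono' measurableSet_Ioi hlevel
    _ = ENNReal.ofReal p * (2 * A * ((ENNReal.ofReal (p - 1))⁻¹ *
          ∫⁻ x, (2 * g x) ^ (p - 1) ∂(volume.withDensity g))) := by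
        rw [lintegral_const_mul' _ _ (by finiteness), h2,
          ENNReal.inv_mul_cancel_left hp1' ENNReal.ofReal_ne_top]
    _ = _ := by
        rw [lintegral_withDensity_eq_lintegral_mul _ hg (by fun_prop)]
        have h3 : ∀ x, (g * fun x => (2 * g x) ^ (p - 1)) x = 2 ^ (p - 1) * g x ^ p := by
          intro x
          simp only [Pi.mul_apply]
          rw [ENNReal.mul_rpow_of_nonneg _ _ hp1.le, mul_left_comm]
          congr 1
          nth_rw 1 [← ENNReal.rpow_one (g x)]
          rw [← ENNReal.rpow_add_of_nonneg _ _ zero_le_one hp1.le]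
          congr 1; ring
        simp_rw [h3]
        rw [lintegral_const_mul' _ _ (by finiteness)]
        ring

end Maximal

/-- Jensen's inequality for the average of the power `p` of a function. -/
lemma MeasureTheory.inv_mul_setLIntegral_rpow_le {α : Type*} [MeasurableSpace α] {μ : Measure α}
    {s : Set α} (hs0 : μ s ≠ 0) (hs : μ s ≠ ⊤) {g : α → ℝ≥0∞}
    (hg : AEMeasurable g (μ.restrict s)) {p : ℝ} (hp : 1 < p) :
    ((μ s)⁻¹ * ∫⁻ x in s, g x ∂μ) ^ p ≤ (μ s)⁻¹ * ∫⁻ x in s, g x ^ p ∂μ := by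
  have hp0 : 0 < p := by linarith
  have hpq := Real.HolderConjugate.conjExponent hp
  -- Hölder's inequality against the constant `1`.
  have h := ENNReal.lintegral_mul_le_Lp_mul_Lq (μ.restrict s) hpq hg
    (aemeasurable_const (b := (1 : ℝ≥0∞)))
  simp only [Pi.mul_apply, mul_one, ENNReal.one_rpow, lintegral_const, one_mul,
    Measure.restrict_apply_univ] at h
  calc ((μ s)⁻¹ * ∫⁻ x in s, g x ∂μ) ^ p
      ≤ ((μ s)⁻¹ * ((∫⁻ x in s, g x ^ p ∂μ) ^ (1 / p) * μ s ^ (1 / p.conjExponent))) ^ p := by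
        gcongr
    _ = (μ s)⁻¹ * ∫⁻ x in s, g x ^ p ∂μ := by
        have he : 1 / p.conjExponent * p = p - 1 := by
          rw [Real.conjExponent]; field_simp
        rw [ENNReal.mul_rpow_of_nonneg _ _ hp0.le, ENNReal.mul_rpow_of_nonneg _ _ hp0.le,
          ← ENNReal.rpow_mul, ← ENNReal.rpow_mul, one_div_mul_cancel hp0.ne', ENNReal.rpow_one,
          he, ENNReal.inv_rpow, ← ENNReal.rpow_neg, mul_left_comm, ← ENNReal.rpow_add _ _ hs0 hs,
          show -p + (p - 1) = -1 by ring, ENNReal.rpow_neg_one, mul_comm]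

/-! ### Morrey norms and the maximal operator. -/

section Morrey

variable {N : ℕ} [Group (RSpace N)] {ν : Fin N → ℝ} {q : RSpace N → ℝ}

lemma setLIntegral_quasiBall_le {p lam : ℝ} {E : Type*} [ENorm E] (f : RSpace N → E)
    (x : RSpace N) {r : ℝ} (hp : 0 < p) (hr : 0 < r) :
    ∫⁻ y in quasiBall q x r, ‖f y‖ₑ ^ p ≤
      ENNReal.ofReal (r ^ lam) * morreyNorm q p lam f ^ p := by
  rw [morreyNorm, ← ENNReal.rpow_mul, one_div_mul_cancel hp.ne', ENNReal.rpow_one]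
  have h := le_iSup_of_le x (le_iSup₂_of_le (f := fun (r : ℝ) (_ : 0 < r) =>
    ENNReal.ofReal (r ^ (-lam)) * ∫⁻ y in quasiBall q x r, ‖f y‖ₑ ^ p) r hr le_rfl)
    (f := fun x => ⨆ (r : ℝ) (_ : 0 < r),
      ENNReal.ofReal (r ^ (-lam)) * ∫⁻ y in quasiBall q x r, ‖f y‖ₑ ^ p)
  grw [← h]
  rw [← mul_assoc, ← ENNReal.ofReal_mul (by positivity), ← Real.rpow_add hr]
  simp

lemma morreyNorm_le {p lam : ℝ} {E : Type*} [ENorm E] {f : RSpace N → E} {M : ℝ≥0∞}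
    (hp : 0 < p)
    (h : ∀ (x : RSpace N) (r : ℝ), 0 < r →
      ∫⁻ y in quasiBall q x r, ‖f y‖ₑ ^ p ≤ ENNReal.ofReal (r ^ lam) * M) :
    morreyNorm q p lam f ≤ M ^ (1 / p) := by
  unfold morreyNorm
  gcongr
  refine iSup_le fun x => iSup₂_le fun r hr => ?_
  grw [h x r hr]
  rw [← mul_assoc, ← ENNReal.ofReal_mul (by positivity), ← Real.rpow_add hr]
  simp

lemma morreyNorm_congr_ae {p lam : ℝ} {E F : Type*} [ENorm E] [ENorm F] {f : RSpace N → E}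
    {g : RSpace N → F} (h : ∀ᵐ x, ‖f x‖ₑ = ‖g x‖ₑ) :
    morreyNorm q p lam f = morreyNorm q p lam g := by
  unfold morreyNorm
  congr 1
  refine iSup_congr fun x => iSup_congr fun r => iSup_congr fun _ => ?_
  congr 1
  refine lintegral_congr_ae (ae_restrict_of_ae ?_)
  filter_upwards [h] with y hy
  rw [hy]

/-- Inside a ball, the maximal function is controlled by the maximal function of the restriction
to an enlarged ball, up to a constant given by the Morrey norm. -/
lemma maximalFunction_rpow_le_of_mem_quasiBall (hG : IsHomogeneousGroup ν)
    (hq : IsHomogeneousQuasiNorm ν q) {p lam : ℝ} (hp : 1 < p)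
    (hlamQ : lam < homogeneousDimension ν) {K : ℝ}
    (htri : ∀ x y z : RSpace N, ∀ r : ℝ, 0 < r →
      y ∈ quasiBall q x r → z ∈ quasiBall q y r → z ∈ quasiBall q x (K * r))
    {g : RSpace N → ℝ≥0∞} (hg : Measurable g) {x₀ x : RSpace N} {R : ℝ} (hR : 0 < R)
    (hx : x ∈ quasiBall q x₀ R) :
    maximalFunction q g x ^ p ≤
      maximalFunction q ((quasiBall q x₀ (K * R)).indicator g) x ^ p +
        (volume (quasiBall q (1 : RSpace N) 1))⁻¹ *
          ENNReal.ofReal (R ^ (lam - homogeneousDimension ν)) * morreyNorm q p lam g ^ p := by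
  have hp0 : 0 < p := by linarith
  set T := (volume (quasiBall q (1 : RSpace N) 1))⁻¹ *
    ENNReal.ofReal (R ^ (lam - homogeneousDimension ν)) * morreyNorm q p lam g ^ p
  have hmax : maximalFunction q g x ≤
      max (maximalFunction q ((quasiBall q x₀ (K * R)).indicator g) x) (T ^ p⁻¹) := by
    refine iSup₂_le fun r hr => ?_
    -- For `r ≤ R`, `B(x, r)` lies in `B(x₀, K R)` and truncation changes nothing; for `r ≥ R`,
    -- Jensen's inequality and the Morrey bound on `B(x, r)` apply.
    rcases le_total r R with hrR | hrR
    · refine le_max_of_le_left (le_trans (le_of_eq ?_) (le_maximalFunction _ x hr))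
      congr 1
      refine setLIntegral_congr_fun (measurableSet_quasiBall hG hq x r) fun y hy => ?_
      exact (indicator_of_mem (htri x₀ x y R hR hx (quasiBall_mono hrR hy)) g).symm
    · apply le_max_of_le_right
      rw [ENNReal.le_rpow_inv_iff hp0]
      refine (inv_mul_setLIntegral_rpow_le (volume_quasiBall_ne_zero hG hq x hr)
        (volume_quasiBall_ne_top hG hq x hr) hg.aemeasurable hp).trans ?_
      have hI : ∫⁻ y in quasiBall q x r, g y ^ p ≤
          ENNReal.ofReal (r ^ lam) * morreyNorm q p lam g ^ p :=
        setLIntegral_quasiBall_le (E := ℝ≥0∞) g x hp0 hr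
      grw [hI]
      have hrQ : 0 < r ^ homogeneousDimension ν := Real.rpow_pos_of_pos hr _
      rw [volume_quasiBall hG hq x hr, ENNReal.mul_inv (.inl (by simpa using hrQ))
        (.inl ENNReal.ofReal_ne_top), ← ENNReal.ofReal_inv_of_pos hrQ]
      calc _ = (volume (quasiBall q (1 : RSpace N) 1))⁻¹ *
            ENNReal.ofReal (r ^ (lam - homogeneousDimension ν)) * morreyNorm q p lam g ^ p := by
            rw [Real.rpow_sub hr, div_eq_mul_inv, ENNReal.ofReal_mul (by positivity)]
            ring
        _ ≤ T := by
            unfold T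
            gcongr _ * ENNReal.ofReal ?_ * _
            exact (Real.antitoneOn_rpow_Ioi_of_exponent_nonpos (by linarith)) hR hr hrR
  rcases le_max_iff.1 hmax with h | h
  · exact le_add_right (by gcongr)
  · exact le_add_left ((ENNReal.le_rpow_inv_iff hp0).1 h)

/-- The maximal operator is bounded on Morrey spaces. -/
lemma exists_morreyNorm_maximalFunction_le (hG : IsHomogeneousGroup ν)
    (hq : IsHomogeneousQuasiNorm ν q) {p lam : ℝ} (hp : 1 < p) (hlam : 0 < lam)
    (hlamQ : lam < homogeneousDimension ν) :
    ∃ C : ℝ≥0, ∀ g : RSpace N → ℝ≥0∞, Measurable g →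
      morreyNorm q p lam (maximalFunction q g) ≤ C * morreyNorm q p lam g := by
  have hp0 : 0 < p := by linarith
  obtain ⟨K, hK, htri⟩ := exists_quasiTriangle hG hq
  obtain ⟨C, hC, hstrong⟩ := exists_strongType_maximalFunction hG hq (hlam.trans hlamQ) hp
  set Q := homogeneousDimension ν
  set c := volume (quasiBall q (1 : RSpace N) 1)
  have hc0 : c ≠ 0 := volume_quasiBall_one_ne_zero hG hq
  have hc1 : c ≠ ⊤ := (volume_quasiBall_one_lt_top hG hq).ne
  -- `C K ^ λ` comes from the small radii, through the `L^p` bound on `B(x₀, K R)`; the `1` comes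
  -- from the large radii.
  refine ⟨((C * ENNReal.ofReal (K ^ lam) + 1) ^ (1 / p)).toNNReal, fun g hg => ?_⟩
  rw [ENNReal.coe_toNNReal (by finiteness)]
  set Λ := morreyNorm q p lam g
  have hΛ : Λ = (Λ ^ p) ^ (1 / p) := by
    rw [← ENNReal.rpow_mul, mul_one_div_cancel hp0.ne', ENNReal.rpow_one]
  conv_rhs => rw [hΛ]
  rw [← ENNReal.mul_rpow_of_nonneg _ _ (by positivity)]
  refine morreyNorm_le hp0 fun x₀ R hR => ?_
  have hKR : 0 < K * R := by positivity
  calc ∫⁻ x in quasiBall q x₀ R, ‖maximalFunction q g x‖ₑ ^ p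
      ≤ ∫⁻ x in quasiBall q x₀ R,
        (maximalFunction q ((quasiBall q x₀ (K * R)).indicator g) x ^ p +
          c⁻¹ * ENNReal.ofReal (R ^ (lam - Q)) * Λ ^ p) := by
        refine setLIntegral_mono' (measurableSet_quasiBall hG hq x₀ R) fun x hx => ?_
        exact maximalFunction_rpow_le_of_mem_quasiBall hG hq hp hlamQ htri hg hR hx
    _ ≤ C * (∫⁻ x in quasiBall q x₀ (K * R), g x ^ p) +
          c⁻¹ * ENNReal.ofReal (R ^ (lam - Q)) * Λ ^ p * (ENNReal.ofReal (R ^ Q) * c) := by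
        rw [lintegral_add_right _ measurable_const, setLIntegral_const,
          volume_quasiBall hG hq x₀ hR]
        gcongr
        have hm := measurableSet_quasiBall hG hq x₀ (K * R)
        refine (setLIntegral_le_lintegral _ _).trans ((hstrong _ (hg.indicator hm)).trans ?_)
        rw [← lintegral_indicator hm]
        gcongr with x
        by_cases hx : x ∈ quasiBall q x₀ (K * R) <;> simp [hx, hp0]
    _ ≤ C * (ENNReal.ofReal ((K * R) ^ lam) * Λ ^ p) + ENNReal.ofReal (R ^ lam) * Λ ^ p := by
        gcongr ?_ + ?_
        · gcongr
          exact setLIntegral_quasiBall_le (E := ℝ≥0∞) g x₀ hp0 hKR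
        · rw [show R ^ lam = R ^ (lam - Q) * R ^ Q by rw [← Real.rpow_add hR]; simp,
            ENNReal.ofReal_mul (by positivity)]
          apply le_of_eq
          calc _ = (c⁻¹ * c) * (ENNReal.ofReal (R ^ (lam - Q)) * ENNReal.ofReal (R ^ Q) * Λ ^ p) := by
                ring
            _ = _ := by rw [ENNReal.inv_mul_cancel hc0 hc1, one_mul]
    _ = _ := by
        rw [Real.mul_rpow (by positivity) hR.le, ENNReal.ofReal_mul (by positivity)]
        ring

/-- Local integrability gives measurability on compact sets only; countably many of them cover the
space. -/
lemma MemMorrey.aestronglyMeasurable {p lam : ℝ} {u : RSpace N → ℝ} (hu : MemMorrey q p lam u) :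
    AEStronglyMeasurable u volume := by
  rw [← Measure.restrict_univ (μ := (volume : Measure (RSpace N))),
    ← iUnion_compactCovering (RSpace N)]
  exact aestronglyMeasurable_iUnion_iff.2 fun n =>
    (hu.1 _ (isCompact_compactCovering _ n)).aestronglyMeasurable

lemma iUnion_quasiBall_nat : ⋃ n : ℕ, quasiBall q (1 : RSpace N) (n + 1) = univ := by
  refine eq_univ_of_forall fun x => mem_iUnion.2 ?_
  obtain ⟨n, hn⟩ := exists_nat_ge (q (1⁻¹ * x))
  exact ⟨n, show q (1⁻¹ * x) < _ by linarith⟩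

/-- A finite norm makes `f ^ p` integrable on each ball of a countable exhaustion. -/
lemma ae_lt_top_of_morreyNorm_lt_top {p lam : ℝ} (hp : 0 < p) {f : RSpace N → ℝ≥0∞}
    (hf : AEMeasurable f) (h : morreyNorm q p lam f < ⊤) : ∀ᵐ x, f x < ⊤ := by
  rw [← Measure.restrict_univ (μ := (volume : Measure (RSpace N))), ← iUnion_quasiBall_nat (q := q),
    ae_restrict_iUnion_iff]
  intro n
  have hfin : ∫⁻ x in quasiBall q (1 : RSpace N) (n + 1), f x ^ p ≠ ⊤ := by
    refine ((setLIntegral_quasiBall_le (E := ℝ≥0∞) (lam := lam) f 1 hp (by positivity)).trans_lt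
      ?_).ne
    finiteness
  filter_upwards [ae_lt_top' (hf.restrict.pow_const p) hfin] with x hx
  exact (ENNReal.rpow_lt_top_iff_of_pos hp).1 hx

lemma memMorrey_of_morreyNorm_lt_top (hq : IsHomogeneousQuasiNorm ν q) {p lam : ℝ} (hp : 0 < p)
    {f : RSpace N → ℝ} (hf : AEStronglyMeasurable f volume) (h : morreyNorm q p lam f < ⊤) :
    MemMorrey q p lam f := by
  refine ⟨fun S hS => ⟨hf.restrict, ?_⟩, h⟩
  obtain ⟨M, hM⟩ := (hS.image hq.continuous).bddAbove
  have hsub : S ⊆ quasiBall q 1 (|M| + 1) := fun x hx => by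
    have := hM ⟨x, hx, rfl⟩
    rw [quasiBall_one]
    exact lt_of_le_of_lt this (by linarith [le_abs_self M])
  rw [eLpNorm_lt_top_iff_lintegral_rpow_enorm_lt_top (by simpa using hp) ENNReal.ofReal_ne_top,
    ENNReal.toReal_ofReal hp.le]
  refine (lintegral_mono_set hsub).trans_lt
    ((setLIntegral_quasiBall_le (lam := lam) f 1 hp (by positivity)).trans_lt ?_)
  finiteness

lemma morreyNorm_toReal_le {p lam : ℝ} (hp : 0 < p) (f : RSpace N → ℝ≥0∞) :
    morreyNorm q p lam (fun x => (f x).toReal) ≤ morreyNorm q p lam f := by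
  unfold morreyNorm
  gcongr with x r hr y
  rw [Real.enorm_eq_ofReal ENNReal.toReal_nonneg]
  exact ENNReal.ofReal_toReal_le

end Morrey

theorem theorem3p1 {N : ℕ} [Group (RSpace N)] (ν : Fin N → ℝ)
    (hG : IsHomogeneousGroup ν)
    (q : RSpace N → ℝ) (hq : IsHomogeneousQuasiNorm ν q)
    (p lam : ℝ) (hp : 1 < p) (hlam : 0 < lam) (hlamQ : lam < homogeneousDimension ν) :
    ∃ C : ℝ≥0, ∀ u : RSpace N → ℝ, MemMorrey q p lam u →
      (∀ᵐ x, maximalOperator q u x < ⊤) ∧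
      MemMorrey q p lam (fun x => (maximalOperator q u x).toReal) ∧
      morreyNorm q p lam (maximalOperator q u) ≤ C * morreyNorm q p lam u := by
  have hp0 : 0 < p := by linarith
  obtain ⟨C, hC⟩ := exists_morreyNorm_maximalFunction_le hG hq hp hlam hlamQ
  refine ⟨C, fun u hu => ?_⟩
  have hum := hu.aestronglyMeasurable.enorm
  -- The averages depend only on the a.e. class of `|u|`, so a measurable representative gives the
  -- same maximal function at every point.
  have hM : maximalOperator q u = maximalFunction q (hum.mk _) :=
    maximalFunction_congr_ae hum.ae_eq_mk
  have hle : morreyNorm q p lam (maximalOperator q u) ≤ C * morreyNorm q p lam u := by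
    rw [hM, morreyNorm_congr_ae (f := u) (g := hum.mk _) hum.ae_eq_mk]
    exact hC _ hum.measurable_mk
  have hmeas : Measurable (maximalOperator q u) := by
    rw [hM]; exact measurable_maximalFunction hG hq hum.measurable_mk
  have hfin : morreyNorm q p lam (maximalOperator q u) < ⊤ :=
    hle.trans_lt (ENNReal.mul_lt_top ENNReal.coe_lt_top hu.2)
  exact ⟨ae_lt_top_of_morreyNorm_lt_top hp0 hmeas.aemeasurable hfin,
    memMorrey_of_morreyNorm_lt_top hq hp0 hmeas.ennreal_toReal.aestronglyMeasurable
      ((morreyNorm_toReal_le hp0 _).trans_lt hfin), hle⟩
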